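/- Let $\mathbb D$ be the open unit disk in $\mathbb C$ and $|z| := \max(|z_1|,|z_2|)$ for $z=(z_1,z_2)\in\mathbb C^2$. For $\varepsilon\in\mathbb D\setminus\{0\}$ let $g_\varepsilon:\mathbb D^2\to[-\infty,0]$ be the pluricomplex Green function of the bidisk with the three poles $a_0=(0,0)$, $a_1=(\varepsilon,0)$, $a_2=(0,\varepsilon)$, that is, $g_\varepsilon(z)=\sup u(z)$, where the supremum is over all plurisubharmonic functions $u\le 0$ on $\mathbb D^2$ for which there are real constants $C_0,C_1,C_2$ with $u(w)\le\log|w-a_j|+C_j$ for all $w\in\mathbb D^2$ and $j=0,1,2$ (with $\log 0=-\infty$). Let $g:\mathbb D^2\to[-\infty,0]$ be any cluster point, for pointwise convergence on $\mathbb D^2$, of the family $(g_\varepsilon)$ as $\varepsilon\to0$, $\varepsilon\neq 0$. Then $g(z)\le\frac32\log|z|$ for every $z\in\mathbb D^2$, and $g(z_1,-z_1)=2\log|z_1|$ for every $z_1\in\mathbb D$. -/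

import Mathlib

open Filter Topology MeasureTheory Set

/-- The mean over the unit circle of an extended-real-valued function `f`,
`(1 / 2π) ∫₀^{2π} f (e^{iθ}) dθ`, computed as the mean of the positive part minus the mean of the
negative part. It is the usual mean, a number in `[-∞, ∞)`, as soon as `f` is measurable and bounded
above on the circle; this is the case for an upper semicontinuous `f < +∞`. -/
noncomputable def unitCircleMean (f : ℂ → EReal) : EReal :=
  ((ENNReal.ofReal (2 * Real.pi))⁻¹ *
      ∫⁻ θ in Ioc (0 : ℝ) (2 * Real.pi), (f (circleMap 0 1 θ)).toENNReal : ENNReal) -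
  ((ENNReal.ofReal (2 * Real.pi))⁻¹ *
      ∫⁻ θ in Ioc (0 : ℝ) (2 * Real.pi), (-f (circleMap 0 1 θ)).toENNReal : ENNReal)

/-- `u : Ω → [-∞, ∞)` is plurisubharmonic on the open set `Ω`: it is upper semicontinuous and has
the sub-mean value property on every closed disk `{a + ζ b : |ζ| ≤ 1}` of a complex line that lies
in `Ω`. The constant `-∞` is allowed. Only the values of `u` on `Ω` matter. -/
structure IsPlurisubharmonicOn {E : Type*} [NormedAddCommGroup E] [NormedSpace ℂ E]
    (u : E → EReal) (Ω : Set E) : Prop where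
  lt_top : ∀ z ∈ Ω, u z < ⊤
  upperSemicontinuousOn : UpperSemicontinuousOn u Ω
  submean : ∀ a b : E, (∀ ζ : ℂ, ‖ζ‖ ≤ 1 → a + ζ • b ∈ Ω) →
    u a ≤ unitCircleMean (fun ζ => u (a + ζ • b))

/-- The competitors in the definition of the Green function of `Ω` with set of poles `P`:
nonpositive plurisubharmonic functions `u` on `Ω` such that for each pole `a` there is a real
constant `C` with `u z ≤ log |z - a| + C` on `Ω`. Here `ENNReal.log 0 = -∞`. -/
def greenCompetitors {E : Type*} [NormedAddCommGroup E] [NormedSpace ℂ E]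
    (Ω P : Set E) : Set (E → EReal) :=
  {u | IsPlurisubharmonicOn u Ω ∧ (∀ z ∈ Ω, u z ≤ 0) ∧
    ∀ a ∈ P, ∃ C : ℝ, ∀ z ∈ Ω, u z ≤ ENNReal.log ‖z - a‖ₑ + (C : EReal)}

/-- The pluricomplex Green function of `Ω` with (logarithmic) poles at the points of `P`. -/
noncomputable def pluricomplexGreen {E : Type*} [NormedAddCommGroup E] [NormedSpace ℂ E]
    (Ω P : Set E) (z : E) : EReal :=
  ⨆ u ∈ greenCompetitors Ω P, u z

/-- The unit bidisk in `ℂ²`. The norm of `ℂ × ℂ` is `max (|z₁|, |z₂|)`. -/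
def bidisk : Set (ℂ × ℂ) := Metric.ball (0 : ℂ) 1 ×ˢ Metric.ball (0 : ℂ) 1

/-- The Green function of the bidisk with the three poles `(0, 0)`, `(ε₁, 0)`, `(0, ε₂)`. -/
noncomputable def threePoleGreen (ε₁ ε₂ : ℂ) (z : bidisk) : EReal :=
  pluricomplexGreen bidisk {((0 : ℂ), (0 : ℂ)), (ε₁, 0), (0, ε₂)} (z : ℂ × ℂ)

/-! The Green function is squeezed between an explicit competitor and holomorphic disks. A disk in
the bidisk that sends parameters `τ` to distinct poles bounds `g_ε` at the image of `ζ` by about `∑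
log |ζ - τ|`, by the maximum principle (`pluricomplexGreen_comp_le`). As `ε → 0` all `τ` tend to
`0`, so `k` poles give `k log |ζ|`.

A cubic perturbation of `t ↦ (a t², b t²)` meets all three poles and reaches `z` at a parameter `ζ`
with `|ζ|² = |z|`; hence `3 log |ζ| = (3/2) log |z|`. On the antidiagonal, a perturbation of `t ↦
(t, -t)` through `(ε, 0)` and `(0, ε)` gives `2 log |z₁|`, and the competitor `log |z₁ z₂|` gives
the reverse inequality.

Plurisubharmonicity is assumed only on affine disks. The maximum principle along curved disks is
obtained by doubling variables: the point `x` and the parameter `ζ` vary independently, with a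
penalty `n |x - f ζ|²`. -/

/-! ### Circle means and harmonic majorants -/

theorem unitCircleMean_mono {f g : ℂ → EReal} (h : ∀ θ : ℝ, f (circleMap 0 1 θ) ≤ g (circleMap 0 1 θ)) :
    unitCircleMean f ≤ unitCircleMean g := by
  unfold unitCircleMean
  apply EReal.sub_le_sub
  · apply EReal.coe_ennreal_le_coe_ennreal_iff.2
    gcongr with θ
    exact EReal.toENNReal_le_toENNReal (h θ)
  · apply EReal.coe_ennreal_le_coe_ennreal_iff.2
    gcongr with θ
    exact EReal.toENNReal_le_toENNReal (EReal.neg_le_neg_iff.2 (h θ))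

/-- Equality almost everywhere is what logarithms need: at a zero on the circle the extended
logarithm is `-∞`, while `Real.log 0 = 0`. -/
theorem unitCircleMean_eq_circleAverage {f : ℂ → EReal} {q : ℂ → ℝ} (hq : CircleIntegrable q 0 1)
    (h : ∀ᵐ θ : ℝ ∂volume.restrict (Ioc 0 (2 * Real.pi)),
      f (circleMap 0 1 θ) = (q (circleMap 0 1 θ) : EReal)) :
    unitCircleMean f = ((Real.circleAverage q 0 1 : ℝ) : EReal) := by
  have hpi : (0 : ℝ) < 2 * Real.pi := by positivity
  have hint : Integrable (fun θ => q (circleMap 0 1 θ)) (volume.restrict (Ioc 0 (2 * Real.pi))) := by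
    have := hq
    rw [CircleIntegrable, intervalIntegrable_iff_integrableOn_Ioc_of_le hpi.le] at this
    exact this
  have h1 : ∫⁻ θ in Ioc (0 : ℝ) (2 * Real.pi), (f (circleMap 0 1 θ)).toENNReal
      = ∫⁻ θ in Ioc (0 : ℝ) (2 * Real.pi), ENNReal.ofReal (q (circleMap 0 1 θ)) := by
    apply lintegral_congr_ae
    filter_upwards [h] with θ hθ
    rw [hθ, EReal.toENNReal_of_ne_top (by simp), EReal.toReal_coe]
  have h2 : ∫⁻ θ in Ioc (0 : ℝ) (2 * Real.pi), (-f (circleMap 0 1 θ)).toENNReal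
      = ∫⁻ θ in Ioc (0 : ℝ) (2 * Real.pi), ENNReal.ofReal (-q (circleMap 0 1 θ)) := by
    apply lintegral_congr_ae
    filter_upwards [h] with θ hθ
    rw [hθ, ← EReal.coe_neg, EReal.toENNReal_of_ne_top (by simp), EReal.toReal_coe]
  have key : ∀ x : ENNReal, x ≠ ⊤ →
      (((ENNReal.ofReal (2 * Real.pi))⁻¹ * x : ENNReal) : EReal)
        = (((2 * Real.pi)⁻¹ * x.toReal : ℝ) : EReal) := by
    intro x hx
    have hne : (ENNReal.ofReal (2 * Real.pi))⁻¹ * x ≠ ⊤ :=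
      ENNReal.mul_ne_top (by simp [Real.pi_pos]) hx
    rw [← EReal.coe_ennreal_toReal hne, ENNReal.toReal_mul, ENNReal.toReal_inv,
      ENNReal.toReal_ofReal hpi.le]
  have f1 : ∫⁻ θ in Ioc (0 : ℝ) (2 * Real.pi), ENNReal.ofReal (q (circleMap 0 1 θ)) ≠ ⊤ :=
    hint.lintegral_lt_top.ne
  have f2 : ∫⁻ θ in Ioc (0 : ℝ) (2 * Real.pi), ENNReal.ofReal (-q (circleMap 0 1 θ)) ≠ ⊤ :=
    hint.neg.lintegral_lt_top.ne
  unfold unitCircleMean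
  rw [h1, h2, key _ f1, key _ f2, ← EReal.coe_sub, Real.circleAverage_def,
    intervalIntegral.integral_of_le hpi.le,
    integral_eq_lintegral_pos_part_sub_lintegral_neg_part hint, smul_eq_mul, mul_sub]

open InnerProductSpace in
theorem IsPlurisubharmonicOn.le_of_le_harmonic {E : Type*} [NormedAddCommGroup E]
    [NormedSpace ℂ E] {u : E → EReal} {Ω : Set E} (hu : IsPlurisubharmonicOn u Ω) {x b : E}
    {c : ℂ} {ρ : ℝ} (hρ : 0 ≤ ρ) (hΩ : ∀ z : ℂ, ‖z - c‖ ≤ ρ → x + (z - c) • b ∈ Ω) {H : ℂ → ℝ}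
    (hH : HarmonicOnNhd H (Metric.closedBall c ρ))
    (hle : ∀ z : ℂ, ‖z - c‖ = ρ → u (x + (z - c) • b) ≤ (H z : EReal)) :
    u x ≤ (H c : EReal) := by
  have h1 : u x ≤ unitCircleMean (fun ζ => u (x + ζ • ((ρ : ℂ) • b))) := by
    apply hu.submean
    intro ζ hζ
    have := hΩ (c + ζ * ρ) (by
      rw [add_sub_cancel_left, norm_mul, Complex.norm_real, Real.norm_of_nonneg hρ]
      exact mul_le_of_le_one_left hρ hζ)
    rwa [add_sub_cancel_left, ← smul_smul] at this
  have hav : Real.circleAverage H c ρ = H c := by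
    apply InnerProductSpace.HarmonicOnNhd.circleAverage_eq
    rwa [abs_of_nonneg hρ]
  have hci : CircleIntegrable H c ρ := by
    apply ContinuousOn.circleIntegrable hρ
    exact hH.continuousOn.mono Metric.sphere_subset_closedBall
  have hcm : ∀ θ : ℝ, c + circleMap 0 1 θ * (ρ : ℂ) = circleMap c ρ θ := by
    intro θ; simp [circleMap, mul_comm]
  have h2 : unitCircleMean (fun ζ => u (x + ζ • ((ρ : ℂ) • b)))
      ≤ unitCircleMean (fun ζ => (H (c + ζ * ρ) : EReal)) := by
    apply unitCircleMean_mono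
    intro θ
    have := hle (c + circleMap 0 1 θ * ρ) (by simp [abs_of_nonneg hρ])
    rwa [add_sub_cancel_left, ← smul_smul] at this
  refine h1.trans (h2.trans ?_)
  rw [unitCircleMean_eq_circleAverage (q := fun ζ => H (c + ζ * ρ))]
  · have : Real.circleAverage (fun ζ => H (c + ζ * ρ)) 0 1 = H c := by
      rw [← hav]
      simp only [Real.circleAverage_def, hcm]
    rw [this]
  · unfold CircleIntegrable at hci ⊢
    simpa only [hcm] using hci
  · exact Eventually.of_forall fun θ => rfl

/-! ### The maximum principle along a holomorphic curve -/

theorem HasDerivAt.exists_norm_sub_le {f : ℂ → ℂ} {f' ζ : ℂ} (hf : HasDerivAt f f' ζ) {e : ℝ}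
    (he : 0 < e) : ∀ᶠ z in 𝓝 ζ, ‖f z - f ζ - (z - ζ) * f'‖ ≤ e * ‖z - ζ‖ := by
  have := (hasDerivAt_iff_isLittleO.1 hf).bound he
  simpa [smul_eq_mul] using this

theorem Complex.norm_sq_eq_add_re (c w : ℂ) :
    ‖w‖ ^ 2 = ‖c‖ ^ 2 + 2 * ((starRingEnd ℂ) c * (w - c)).re + ‖w - c‖ ^ 2 := by
  rw [← Complex.normSq_eq_norm_sq, ← Complex.normSq_eq_norm_sq, ← Complex.normSq_eq_norm_sq]
  simp [Complex.normSq_apply]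
  ring

open InnerProductSpace in
/-- At a point where `u x - h ζ + κ |ζ|² - n |x - f ζ|²` has a local maximum, the sub-mean value
property along the tangent disk of `f` fails. -/
theorem IsPlurisubharmonicOn.not_isLocalMax_penalized {u : ℂ × ℂ → EReal} {Ω : Set (ℂ × ℂ)}
    (hu : IsPlurisubharmonicOn u Ω) {f₁ f₂ : ℂ → ℂ} (hf₁ : Differentiable ℂ f₁)
    (hf₂ : Differentiable ℂ f₂) {h : ℂ → ℝ} {ζ : ℂ} (hh : HarmonicAt h ζ)
    {x : ℂ × ℂ} {U κ n : ℝ} (hκ : 0 < κ) (hn : 0 < n) (hx : Ω ∈ 𝓝 x) (hU : u x = (U : EReal))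
    (hmax : ∀ᶠ p : (ℂ × ℂ) × ℂ in 𝓝 (x, ζ),
      u p.1 ≤ ((U + (-h ζ + κ * ‖ζ‖ ^ 2 - n * (‖x.1 - f₁ ζ‖ ^ 2 + ‖x.2 - f₂ ζ‖ ^ 2))
        - (-h p.2 + κ * ‖p.2‖ ^ 2
          - n * (‖p.1.1 - f₁ p.2‖ ^ 2 + ‖p.1.2 - f₂ p.2‖ ^ 2)) : ℝ) : EReal)) : False := by
  set b : ℂ × ℂ := (deriv f₁ ζ, deriv f₂ ζ) with hb
  have hcont : Tendsto (fun z : ℂ => (x + (z - ζ) • b, z)) (𝓝 ζ) (𝓝 (x, ζ)) := by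
    have : Continuous (fun z : ℂ => (x + (z - ζ) • b, z)) := by fun_prop
    simpa using this.tendsto ζ
  have hcont1 : Tendsto (fun z : ℂ => x + (z - ζ) • b) (𝓝 ζ) (𝓝 x) := by
    have : Continuous (fun z : ℂ => x + (z - ζ) • b) := by fun_prop
    simpa using this.tendsto ζ
  -- With this tolerance the two squared Taylor remainders, weighted by `n`, cost at most `κ ρ² /
  -- 2`, half of the gain `κ ρ²` from `κ |z|²`.
  set e : ℝ := Real.sqrt (κ / (4 * n)) with he
  have he0 : 0 < e := Real.sqrt_pos.2 (by positivity)
  have hesq : n * e ^ 2 = κ / 4 := by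
    rw [he, Real.sq_sqrt (by positivity)]; field_simp
  have ev := (hcont.eventually hmax).and ((hcont1.eventually hx).and (hh.eventually.and
    (((hf₁ ζ).hasDerivAt.exists_norm_sub_le he0).and ((hf₂ ζ).hasDerivAt.exists_norm_sub_le he0))))
  obtain ⟨ρ, hρ, hball⟩ := Metric.nhds_basis_closedBall.eventually_iff.1 ev
  set c₁ := x.1 - f₁ ζ with hc₁
  set c₂ := x.2 - f₂ ζ with hc₂
  -- On the circle, `|c + w|² = |c|² + 2 Re (c̄ w) + |w|²` splits each square into a real part of a
  -- holomorphic function and a small or constant term. `Re W` collects the former; `h + Re W`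
  -- equals `U - κ ρ² / 2` at the centre, below `u x = U`.
  set W : ℂ → ℂ := fun z => ((U - h ζ - κ / 2 * ρ ^ 2 : ℝ) : ℂ)
    + (((-(2 * κ) : ℝ) : ℂ) * ((starRingEnd ℂ) ζ * (z - ζ))
      + ((2 * n : ℝ) : ℂ) * ((starRingEnd ℂ) c₁ * ((z - ζ) * deriv f₁ ζ - (f₁ z - f₁ ζ))
        + (starRingEnd ℂ) c₂ * ((z - ζ) * deriv f₂ ζ - (f₂ z - f₂ ζ)))) with hW
  have hWd : Differentiable ℂ W := by fun_prop
  have key := hu.le_of_le_harmonic (x := x) (b := b) (c := ζ) (ρ := ρ) hρ.le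
    (fun z hz => (hball (mem_closedBall_iff_norm.2 hz)).2.1)
    (H := h + fun z => (W z).re)
    (fun z hz => (hball hz).2.2.1.add (hWd.analyticAt z).harmonicAt_re)
    (by
      intro z hz
      obtain ⟨h1, -, -, h2, h3⟩ := hball (mem_closedBall_iff_norm.2 hz.le)
      refine h1.trans ?_
      rw [EReal.coe_le_coe_iff]
      have e1 : (x + (z - ζ) • b).1 - f₁ z = c₁ + ((z - ζ) * deriv f₁ ζ - (f₁ z - f₁ ζ)) := by
        simp [hb, hc₁]; ring
      have e2 : (x + (z - ζ) • b).2 - f₂ z = c₂ + ((z - ζ) * deriv f₂ ζ - (f₂ z - f₂ ζ)) := by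
        simp [hb, hc₂]; ring
      simp only [e1, e2]
      rw [Complex.norm_sq_eq_add_re c₁ (c₁ + _), Complex.norm_sq_eq_add_re c₂ (c₂ + _),
        Complex.norm_sq_eq_add_re ζ z, add_sub_cancel_left, add_sub_cancel_left, hz]
      rw [hz, norm_sub_rev] at h2 h3
      have h2' := mul_le_mul_of_nonneg_left (pow_le_pow_left₀ (norm_nonneg _) h2 2) hn.le
      have h3' := mul_le_mul_of_nonneg_left (pow_le_pow_left₀ (norm_nonneg _) h3 2) hn.le
      rw [mul_pow, ← mul_assoc, hesq] at h2' h3'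
      simp only [hW, Pi.add_apply, Complex.add_re, Complex.ofReal_re, Complex.re_ofReal_mul]
      linarith)
  rw [hU, EReal.coe_le_coe_iff] at key
  simp only [hW, Pi.add_apply, Complex.add_re, Complex.ofReal_re, Complex.re_ofReal_mul, sub_self,
    mul_zero, zero_mul, Complex.zero_re, add_zero] at key
  nlinarith [mul_pos hκ (pow_pos hρ 2)]

open InnerProductSpace in
/-- The maximum principle for a plurisubharmonic function along a holomorphic curve. -/
theorem IsPlurisubharmonicOn.comp_le_of_le_boundary {u : ℂ × ℂ → EReal}
    (hu : IsPlurisubharmonicOn u (Metric.ball 0 1)) (hu0 : ∀ z ∈ Metric.ball (0 : ℂ × ℂ) 1, u z ≤ 0)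
    {f₁ f₂ : ℂ → ℂ} (hf₁ : Differentiable ℂ f₁) (hf₂ : Differentiable ℂ f₂) {A V : Set ℂ}
    (hA : IsCompact A) (hV : IsOpen V) (hVA : V ⊆ A)
    (hfA : ∀ ζ ∈ A, (f₁ ζ, f₂ ζ) ∈ Metric.ball (0 : ℂ × ℂ) 1) {h : ℂ → ℝ}
    (hc : ContinuousOn h A) (hh : HarmonicOnNhd h V)
    (hb : ∀ ζ ∈ A, ζ ∉ V → u (f₁ ζ, f₂ ζ) ≤ (h ζ : EReal)) :
    ∀ ζ ∈ A, u (f₁ ζ, f₂ ζ) ≤ (h ζ : EReal) := by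
  have hfc : Continuous fun ζ => (f₁ ζ, f₂ ζ) := hf₁.continuous.prodMk hf₂.continuous
  intro ζ₀ hζ₀
  by_contra hcon
  rw [not_le] at hcon
  obtain ⟨R, hR⟩ := hA.isBounded.exists_norm_le
  obtain ⟨ζm, hζm, hmaxm⟩ := hA.exists_isMaxOn ⟨ζ₀, hζ₀⟩ (hfc.norm.continuousOn)
  set ρ₀ := ‖(f₁ ζm, f₂ ζm)‖ with hρ₀
  have hρ₀1 : ρ₀ < 1 := mem_ball_zero_iff.1 (hfA ζm hζm)
  have hρ₀0 : 0 ≤ ρ₀ := norm_nonneg _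
  have hfle : ∀ ζ ∈ A, ‖(f₁ ζ, f₂ ζ)‖ ≤ ρ₀ := fun ζ hζ => hmaxm hζ
  set ρ := (1 + ρ₀) / 2 with hρ
  set X : Set (ℂ × ℂ) := Metric.closedBall 0 ρ with hX
  have hXc : IsCompact X := isCompact_closedBall _ _
  have hXΩ : X ⊆ Metric.ball 0 1 := Metric.closedBall_subset_ball (by linarith)
  obtain ⟨c, hc1, hc2⟩ := EReal.lt_iff_exists_real_btwn.1 hcon
  rw [EReal.coe_lt_coe_iff] at hc1
  set m := c - h ζ₀ with hm
  have hm0 : 0 < m := by linarith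
  -- Small enough that `κ |ζ|² < m` on `A`, so that `u ∘ f + ψ < m` on `A \ V`.
  set κ := m / (2 * (R ^ 2 + 1)) with hκ
  have hκ0 : 0 < κ := by positivity
  have hκR : κ * R ^ 2 < m := by
    rw [hκ, div_mul_eq_mul_div, div_lt_iff₀ (by positivity)]
    nlinarith [mul_nonneg hm0.le (sq_nonneg R)]
  set ψ : ℂ → ℝ := fun ζ => -h ζ + κ * ‖ζ‖ ^ 2 with hψ
  have hψc : ContinuousOn ψ A := by fun_prop
  have usc : ∀ k : (ℂ × ℂ) × ℂ → ℝ, ContinuousOn k (X ×ˢ A) →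
      UpperSemicontinuousOn (fun p => u p.1 + (k p : EReal)) (X ×ˢ A) := by
    intro k hk
    refine UpperSemicontinuousOn.add' (f := fun p : (ℂ × ℂ) × ℂ => u p.1) ?_ ?_ ?_
    · exact (hu.upperSemicontinuousOn.mono hXΩ).comp continuous_fst.continuousOn
        (fun p hp => hp.1)
    · exact (continuous_coe_real_ereal.comp_continuousOn hk).upperSemicontinuousOn
    · intro p hp
      exact EReal.continuousAt_add (Or.inr (by simp)) (Or.inr (by simp))
  have hψ2 : ContinuousOn (fun p : (ℂ × ℂ) × ℂ => ψ p.2) (X ×ˢ A) :=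
    hψc.comp continuous_snd.continuousOn fun p hp => hp.2
  set P : (ℂ × ℂ) × ℂ → ℝ := fun p => ‖p.1.1 - f₁ p.2‖ ^ 2 + ‖p.1.2 - f₂ p.2‖ ^ 2 with hP
  have hPc : Continuous P := by
    have := hf₁.continuous
    have := hf₂.continuous
    fun_prop
  have hcompact : IsCompact (((X ×ˢ A) ∩ (fun p => u p.1 + (ψ p.2 : EReal)) ⁻¹' Ici (m : EReal))
      ∩ Prod.snd ⁻¹' Vᶜ) :=
    ((usc _ hψ2).isCompact_inter_preimage_Ici (hXc.prod hA) _).inter_right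
      (hV.isClosed_compl.preimage continuous_snd)
  -- If the penalty `P` vanished here, `x` would be `f ζ` with `ζ ∉ V`, against the boundary bound.
  -- By compactness `P ≥ δ > 0` on this set.
  obtain ⟨δ, hδ0, hδ⟩ := hcompact.exists_forall_le' (a := 0) hPc.continuousOn (by
    rintro ⟨x, ζ⟩ ⟨⟨⟨hx, hζ⟩, hF⟩, hζV⟩
    by_contra hP0
    have hs : ‖x.1 - f₁ ζ‖ ^ 2 + ‖x.2 - f₂ ζ‖ ^ 2 ≤ 0 := not_lt.1 hP0
    have hx1 : x.1 = f₁ ζ := sub_eq_zero.1 (norm_eq_zero.1 (by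
      nlinarith [sq_nonneg ‖x.1 - f₁ ζ‖, sq_nonneg ‖x.2 - f₂ ζ‖]))
    have hx2 : x.2 = f₂ ζ := sub_eq_zero.1 (norm_eq_zero.1 (by
      nlinarith [sq_nonneg ‖x.1 - f₁ ζ‖, sq_nonneg ‖x.2 - f₂ ζ‖]))
    have hx' : x = (f₁ ζ, f₂ ζ) := Prod.ext hx1 hx2
    have h1 := hb ζ hζ hζV
    have hF' : (m : EReal) ≤ u x + (ψ ζ : EReal) := hF
    rw [hx'] at hF'
    have h2 := hF'.trans (add_le_add_left h1 _)
    rw [← EReal.coe_add, EReal.coe_le_coe_iff] at h2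
    have h3 : ‖ζ‖ ^ 2 ≤ R ^ 2 := pow_le_pow_left₀ (norm_nonneg _) (hR ζ hζ) 2
    have := mul_le_mul_of_nonneg_left h3 hκ0.le
    simp only [hψ] at h2
    linarith)
  obtain ⟨B, hB⟩ := (hA.bddAbove_image hψc)
  have hB' : ∀ ζ ∈ A, ψ ζ ≤ B := fun ζ hζ => hB (mem_image_of_mem _ hζ)
  set δ' := min δ ((ρ - ρ₀) ^ 2) with hδ'
  have hρρ : 0 < ρ - ρ₀ := by rw [hρ]; linarith
  have hδ'0 : 0 < δ' := lt_min hδ0 (pow_pos hρρ 2)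
  -- Since `u ≤ 0` and `ψ ≤ B`, this weight forces `P < δ'` at the maximum point. Hence `ζ ∈ V` and
  -- `x` is interior to `X`: the maximum is local.
  set n := (|B| + 1) / δ' with hn
  have hn0 : 0 < n := by positivity
  have hGusc := usc (fun p => ψ p.2 - n * P p) (hψ2.sub (by fun_prop))
  have hmem0 : ((f₁ ζ₀, f₂ ζ₀), ζ₀) ∈ X ×ˢ A :=
    ⟨mem_closedBall_zero_iff.2 ((hfle ζ₀ hζ₀).trans (by linarith)), hζ₀⟩
  obtain ⟨⟨x, ζ⟩, ⟨hx, hζ⟩, hmax⟩ := hGusc.exists_isMaxOn ⟨_, hmem0⟩ (hXc.prod hA)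
  simp only at hx hζ
  have hGm : (m : EReal) ≤ u x + ((ψ ζ - n * P (x, ζ) : ℝ) : EReal) := by
    refine le_trans ?_ (hmax hmem0)
    have hP0 : P ((f₁ ζ₀, f₂ ζ₀), ζ₀) = 0 := by simp [hP]
    simp only [hP0, mul_zero, sub_zero]
    refine le_trans ?_ (add_le_add_left hc2.le _)
    rw [← EReal.coe_add, EReal.coe_le_coe_iff]
    have : 0 ≤ κ * ‖ζ₀‖ ^ 2 := by positivity
    simp only [hψ, hm]
    linarith
  have hux0 := hu0 x (hXΩ hx)
  obtain ⟨U, hU⟩ : ∃ U : ℝ, u x = U := by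
    refine ⟨(u x).toReal, (EReal.coe_toReal ?_ ?_).symm⟩
    · intro htop; rw [htop] at hux0; simp at hux0
    · intro hbot
      rw [hbot, EReal.bot_add] at hGm
      simp at hGm
  rw [hU] at hGm hux0
  rw [← EReal.coe_add, EReal.coe_le_coe_iff] at hGm
  have hU0 : U ≤ 0 := by exact_mod_cast hux0
  have hPnn : 0 ≤ P (x, ζ) := by simp only [hP]; positivity
  have hPlt : P (x, ζ) < δ' := by
    have h1 : n * P (x, ζ) < |B| + 1 := by
      have := hB' ζ hζ
      have := le_abs_self B
      linarith
    rw [hn, div_mul_eq_mul_div, div_lt_iff₀ hδ'0] at h1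
    exact lt_of_mul_lt_mul_left h1 (by positivity)
  have hζV : ζ ∈ V := by
    by_contra hζV
    have : δ ≤ P (x, ζ) := by
      refine hδ (x, ζ) ⟨⟨⟨hx, hζ⟩, ?_⟩, hζV⟩
      show (m : EReal) ≤ u x + (ψ ζ : EReal)
      rw [hU, ← EReal.coe_add, EReal.coe_le_coe_iff]
      have := mul_nonneg hn0.le hPnn
      linarith
    exact absurd (hPlt.trans_le (min_le_left _ _)) (not_lt.2 this)
  have hxint : X ∈ 𝓝 x := by
    apply Filter.mem_of_superset (Metric.isOpen_ball.mem_nhds _) Metric.ball_subset_closedBall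
    have h1 : P (x, ζ) < (ρ - ρ₀) ^ 2 := hPlt.trans_le (min_le_right _ _)
    simp only [hP] at h1
    have h2 : ‖x.1 - f₁ ζ‖ < ρ - ρ₀ := by
      apply lt_of_pow_lt_pow_left₀ 2 hρρ.le
      nlinarith [sq_nonneg ‖x.2 - f₂ ζ‖]
    have h3 : ‖x.2 - f₂ ζ‖ < ρ - ρ₀ := by
      apply lt_of_pow_lt_pow_left₀ 2 hρρ.le
      nlinarith [sq_nonneg ‖x.1 - f₁ ζ‖]
    have h4 : ‖x - (f₁ ζ, f₂ ζ)‖ < ρ - ρ₀ := by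
      rw [Prod.norm_def]; exact max_lt h2 h3
    rw [mem_ball_zero_iff]
    have h5 := norm_add_le (x - (f₁ ζ, f₂ ζ)) (f₁ ζ, f₂ ζ)
    rw [sub_add_cancel] at h5
    linarith [hfle ζ hζ]
  have hAint : A ∈ 𝓝 ζ := mem_of_superset (hV.mem_nhds hζV) hVA
  refine hu.not_isLocalMax_penalized hf₁ hf₂ (hh ζ hζV) hκ0 hn0 (mem_of_superset hxint hXΩ) hU ?_
  rw [nhds_prod_eq]
  filter_upwards [prod_mem_prod hxint hAint] with p hp
  have h1 : u p.1 + ((ψ p.2 - n * P p : ℝ) : EReal) ≤ u x + ((ψ ζ - n * P (x, ζ) : ℝ) : EReal) :=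
    hmax hp
  rw [hU, ← EReal.coe_add] at h1
  rw [EReal.coe_sub]
  exact (EReal.le_sub_iff_add_le (Or.inl (EReal.coe_ne_bot _)) (Or.inl (EReal.coe_ne_top _))).2 h1

/-! ### Upper bounds for Green functions from holomorphic disks -/

theorem bidisk_eq_ball : bidisk = Metric.ball (0 : ℂ × ℂ) 1 :=
  ball_prod_same (0 : ℂ) (0 : ℂ) 1

theorem ENNReal_log_enorm_le {E : Type*} [NormedAddCommGroup E] {w : E} {t : ℝ} (ht : 0 < t)
    (h : ‖w‖ ≤ t) : ENNReal.log ‖w‖ₑ ≤ (Real.log t : EReal) := by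
  rw [← ENNReal.log_ofReal_of_pos ht]
  apply ENNReal.log_monotone
  rw [← ofReal_norm]
  exact ENNReal.ofReal_le_ofReal h

theorem ENNReal_log_enorm {E : Type*} [NormedAddCommGroup E] {w : E} (hw : w ≠ 0) :
    ENNReal.log ‖w‖ₑ = (Real.log ‖w‖ : EReal) := by
  rw [← ENNReal.log_ofReal_of_pos (norm_pos_iff.2 hw), ofReal_norm]

theorem log_norm_prod_sub {T : Finset ℂ} {z : ℂ} (hz : z ∉ T) :
    Real.log ‖∏ τ ∈ T, (z - τ)‖ = ∑ τ ∈ T, Real.log ‖z - τ‖ := by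
  rw [norm_prod, Real.log_prod]
  intro τ hτ
  rw [norm_ne_zero_iff, sub_ne_zero]
  rintro rfl
  exact hz hτ

/-- The logarithmic poles of a competitor along a holomorphic curve. -/
theorem exists_comp_le_log_norm_prod {P : Set (ℂ × ℂ)} {u : ℂ × ℂ → EReal}
    (hu : u ∈ greenCompetitors bidisk P) {f₁ f₂ : ℂ → ℂ} (hf₁ : Differentiable ℂ f₁)
    (hf₂ : Differentiable ℂ f₂) {r : ℝ} (hf : ∀ z : ℂ, ‖z‖ ≤ r → (f₁ z, f₂ z) ∈ bidisk)
    (T : Finset ℂ) (hT : ∀ τ ∈ T, ‖τ‖ < r ∧ (f₁ τ, f₂ τ) ∈ P) :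
    ∃ C : ℝ, ∀ z : ℂ, ‖z‖ ≤ r → z ∉ T →
      u (f₁ z, f₂ z) ≤ ((Real.log ‖∏ τ ∈ T, (z - τ)‖ + C : ℝ) : EReal) := by
  obtain ⟨-, hu0, huP⟩ := hu
  rcases T.eq_empty_or_nonempty with rfl | hTne
  · refine ⟨0, fun z hz _ => (hu0 _ (hf z hz)).trans ?_⟩
    simp
  have hloc : ∀ τ ∈ T, ∃ C : ℝ, ∀ z : ℂ, ‖z‖ ≤ r → z ≠ τ →
      u (f₁ z, f₂ z) ≤ ((Real.log ‖z - τ‖ + C : ℝ) : EReal) := by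
    intro τ hτ
    obtain ⟨hτr, hτP⟩ := hT τ hτ
    obtain ⟨C, hC⟩ := huP _ hτP
    have hfC : ContDiff ℂ 1 fun z => (f₁ z, f₂ z) := hf₁.contDiff.prodMk hf₂.contDiff
    obtain ⟨L, hL⟩ := (hfC.restrict_scalars ℝ).contDiffOn.exists_lipschitzOnWith one_ne_zero
      (convex_closedBall (0 : ℂ) r) (isCompact_closedBall _ _)
    refine ⟨Real.log (L + 1) + C, fun z hz hzτ => (hC _ (hf z hz)).trans ?_⟩
    have hpos : 0 < ‖z - τ‖ := norm_pos_iff.2 (sub_ne_zero.2 hzτ)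
    have hL1 : (0 : ℝ) < L + 1 := by positivity
    have h1 : ‖(f₁ z, f₂ z) - (f₁ τ, f₂ τ)‖ ≤ (L + 1) * ‖z - τ‖ := by
      have := hL.norm_sub_le (mem_closedBall_zero_iff.2 hz) (mem_closedBall_zero_iff.2 hτr.le)
      nlinarith
    refine (add_le_add_left (ENNReal_log_enorm_le (mul_pos hL1 hpos) h1) _).trans ?_
    rw [Real.log_mul hL1.ne' hpos.ne', ← EReal.coe_add, EReal.coe_le_coe_iff]
    linarith
  choose! C hC using hloc
  -- At most one factor of `∏ (z - τ)` vanishes at a given point, so this sum is bounded below by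
  -- some `d > 0`. Everywhere some `τ` has all the other factors under control, and the local bound
  -- at that `τ` suffices.
  have hcont : Continuous fun z : ℂ => ∑ τ ∈ T, ∏ i ∈ T.erase τ, ‖z - i‖ := by fun_prop
  obtain ⟨d, hd0, hd⟩ := (isCompact_closedBall (0 : ℂ) r).exists_forall_le' (a := 0)
    hcont.continuousOn (by
      intro z _
      by_cases hz : z ∈ T
      · refine Finset.sum_pos' (fun _ _ => Finset.prod_nonneg fun _ _ => norm_nonneg _)
          ⟨z, hz, Finset.prod_pos fun i hi => ?_⟩
        rw [norm_pos_iff, sub_ne_zero]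
        exact (Finset.ne_of_mem_erase hi).symm
      · refine Finset.sum_pos (fun τ _ => Finset.prod_pos fun i hi => ?_) hTne
        rw [norm_pos_iff, sub_ne_zero]
        rintro rfl
        exact hz (Finset.mem_of_mem_erase hi))
  have hcard : (0 : ℝ) < T.card := by exact_mod_cast hTne.card_pos
  refine ⟨∑ τ ∈ T, |C τ| - Real.log (d / T.card), fun z hz hzT => ?_⟩
  obtain ⟨τ, hτ, hle⟩ : ∃ τ ∈ T, d / T.card ≤ ∏ i ∈ T.erase τ, ‖z - i‖ := by
    apply Finset.exists_le_of_sum_le hTne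
    rw [Finset.sum_const, nsmul_eq_mul, mul_div_cancel₀ _ hcard.ne']
    exact hd z (mem_closedBall_zero_iff.2 hz)
  have hzτ : z ≠ τ := by rintro rfl; exact hzT hτ
  refine (hC τ hτ z hz hzτ).trans ?_
  rw [EReal.coe_le_coe_iff, norm_prod, ← Finset.mul_prod_erase T _ hτ, Real.log_mul
    (norm_ne_zero_iff.2 (sub_ne_zero.2 hzτ)) ((div_pos hd0 hcard).trans_le hle).ne']
  have h1 := Real.log_le_log (div_pos hd0 hcard) hle
  have h2 : |C τ| ≤ ∑ τ ∈ T, |C τ| :=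
    Finset.single_le_sum (f := fun τ => |C τ|) (fun _ _ => abs_nonneg _) hτ
  linarith [le_abs_self (C τ)]

open InnerProductSpace in
/-- The upper bound for a Green function given by a holomorphic disk through some of the poles. -/
theorem pluricomplexGreen_comp_le {P : Set (ℂ × ℂ)} {f₁ f₂ : ℂ → ℂ} (hf₁ : Differentiable ℂ f₁)
    (hf₂ : Differentiable ℂ f₂) {r : ℝ} (hf : ∀ z : ℂ, ‖z‖ ≤ r → (f₁ z, f₂ z) ∈ bidisk)
    (T : Finset ℂ) (hT : ∀ τ ∈ T, ‖τ‖ < r ∧ (f₁ τ, f₂ τ) ∈ P) {ζ : ℂ} (hζ : ‖ζ‖ ≤ r)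
    (hζT : ζ ∉ T) : pluricomplexGreen bidisk P (f₁ ζ, f₂ ζ) ≤
      ((∑ τ ∈ T, (Real.log ‖ζ - τ‖ - Real.log (r - ‖τ‖)) : ℝ) : EReal) := by
  refine iSup₂_le fun u hu => ?_
  obtain ⟨C, hC⟩ := exists_comp_le_log_norm_prod hu hf₁ hf₂ hf T hT
  obtain ⟨hpsh, hu0, -⟩ := hu
  set Q : ℂ → ℂ := fun z => ∏ τ ∈ T, (z - τ) with hQ
  have hQd : Differentiable ℂ Q := by fun_prop
  have hQc : Continuous Q := hQd.continuous
  have hQT : ∀ z, Q z ≠ 0 → z ∉ T := fun z hz hzT =>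
    hz (Finset.prod_eq_zero hzT (sub_self z))
  have hQζ : 0 < ‖Q ζ‖ := by
    rw [norm_pos_iff, hQ, Finset.prod_ne_zero_iff]
    intro τ hτ
    rw [sub_ne_zero]
    rintro rfl
    exact hζT hτ
  set c := ∑ τ ∈ T, Real.log (r - ‖τ‖) with hc
  rw [Finset.sum_sub_distrib, ← hc, ← log_norm_prod_sub hζT]
  rw [bidisk_eq_ball] at hpsh hu0 hf
  -- The factor `1 - η` makes the majorant's poles weaker than those of `u`, which absorbs the
  -- unknown constant `C` near `T`. On `|z| = r` one has `|z - τ| ≥ r - |τ|`, so the majorant is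
  -- nonnegative there.
  have key : ∀ η ∈ Ioo (0 : ℝ) 1,
      u (f₁ ζ, f₂ ζ) ≤ (((1 - η) * (Real.log ‖Q ζ‖ - c) : ℝ) : EReal) := by
    rintro η ⟨hη0, hη1⟩
    -- The exponential makes `log s + C ≤ (1 - η) (log s - c)` on `|Q| = s`; the minimum keeps `ζ`
    -- in the region `s ≤ |Q|`.
    set s := min (Real.exp (-(C + (1 - η) * c) / η)) ‖Q ζ‖ with hs
    have hs0 : 0 < s := lt_min (Real.exp_pos _) hQζ
    have hlogs : Real.log s ≤ -(C + (1 - η) * c) / η := by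
      rw [Real.log_le_iff_le_exp hs0]; exact min_le_left _ _
    rw [le_div_iff₀ hη0] at hlogs
    refine hpsh.comp_le_of_le_boundary hu0 hf₁ hf₂
      (A := Metric.closedBall 0 r ∩ {z | s ≤ ‖Q z‖}) (V := Metric.ball 0 r ∩ {z | s < ‖Q z‖})
      (h := (1 - η) • ((fun z => Real.log ‖Q z‖) - fun _ => c))
      ((isCompact_closedBall _ _).inter_right (isClosed_le continuous_const hQc.norm))
      (Metric.isOpen_ball.inter (isOpen_lt continuous_const hQc.norm))
      (inter_subset_inter Metric.ball_subset_closedBall fun z (hz : s < ‖Q z‖) => (hz.le : s ≤ ‖Q z‖))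
      (fun z hz => hf z (mem_closedBall_zero_iff.1 hz.1)) ?_ ?_ ?_ ζ
      ⟨mem_closedBall_zero_iff.2 hζ, (min_le_right _ _ : s ≤ ‖Q ζ‖)⟩
    · refine ContinuousOn.const_smul (ContinuousOn.sub ?_ continuousOn_const) _
      exact hQc.norm.continuousOn.log fun z hz => (hs0.trans_le hz.2).ne'
    · intro z hz
      refine HarmonicAt.const_smul (HarmonicAt.sub ?_ (harmonicAt_const c))
      exact (hQd.analyticAt z).harmonicAt_log_norm (norm_pos_iff.1 (hs0.trans hz.2))
    · rintro z ⟨hzr, hzs⟩ hzV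
      have hQz : Q z ≠ 0 := norm_pos_iff.1 (hs0.trans_le hzs)
      rw [mem_closedBall_zero_iff] at hzr
      simp only [Pi.smul_apply, Pi.sub_apply, smul_eq_mul]
      by_cases hlt : ‖z‖ < r
      · have hzs' : ‖Q z‖ = s := by
          refine le_antisymm (not_lt.1 fun h => hzV ⟨mem_ball_zero_iff.2 hlt, h⟩) hzs
        refine (hC z hzr (hQT z hQz)).trans ?_
        show ((Real.log ‖Q z‖ + C : ℝ) : EReal) ≤ _
        rw [hzs', EReal.coe_le_coe_iff]
        linarith
      · have hzr' : ‖z‖ = r := le_antisymm hzr (not_lt.1 hlt)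
        refine (hu0 _ (hf z hzr)).trans ?_
        rw [← EReal.coe_zero, EReal.coe_le_coe_iff]
        refine mul_nonneg (by linarith) (sub_nonneg.2 ?_)
        rw [hQ, log_norm_prod_sub (hQT z hQz), hc]
        refine Finset.sum_le_sum fun τ hτ => Real.log_le_log (by linarith [(hT τ hτ).1]) ?_
        rw [← hzr']
        exact norm_sub_norm_le z τ
  have hlim : Tendsto (fun η : ℝ => (((1 - η) * (Real.log ‖Q ζ‖ - c) : ℝ) : EReal)) (𝓝[>] 0)
      (𝓝 ((Real.log ‖Q ζ‖ - c : ℝ) : EReal)) := by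
    refine (continuous_coe_real_ereal.tendsto _).comp (Tendsto.mono_left ?_ nhdsWithin_le_nhds)
    have : Continuous fun η : ℝ => (1 - η) * (Real.log ‖Q ζ‖ - c) := by fun_prop
    simpa using this.tendsto 0
  refine ge_of_tendsto hlim ?_
  filter_upwards [Ioo_mem_nhdsGT (zero_lt_one' ℝ)] with η hη using key η hη

/-! ### Passage to cluster points -/

/-- An upper bound for a cluster point from asymptotic upper bounds for the family. -/
theorem MapClusterPt.apply_le_of_eventually_le {α X : Type*} {l : Filter α} {F : α → X → EReal}
    {g : X → EReal} (hg : MapClusterPt g l F) {x : X} {c : EReal}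
    (h : ∀ B : ℝ, c < B → ∀ᶠ a in l, F a x ≤ (B : EReal)) : g x ≤ c := by
  rw [← EReal.le_of_forall_lt_iff_le]
  intro B hB
  by_contra hlt
  have hopen : ∀ᶠ k : X → EReal in 𝓝 g, (B : EReal) < k x :=
    ((continuous_apply x).tendsto g).eventually (lt_mem_nhds (not_le.1 hlt))
  obtain ⟨a, ha1, ha2⟩ := ((hg.frequently hopen).and_eventually (h B hB)).exists
  exact absurd ha2 (not_le.2 ha1)

theorem MapClusterPt.le_apply_of_eventually_le {α X : Type*} {l : Filter α} {F : α → X → EReal}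
    {g : X → EReal} (hg : MapClusterPt g l F) {x : X} {c : EReal}
    (h : ∀ᶠ a in l, c ≤ F a x) : c ≤ g x := by
  by_contra hlt
  have hopen : ∀ᶠ k : X → EReal in 𝓝 g, k x < c :=
    ((continuous_apply x).tendsto g).eventually (gt_mem_nhds (not_le.1 hlt))
  obtain ⟨a, ha1, ha2⟩ := ((hg.frequently hopen).and_eventually h).exists
  exact absurd ha2 (not_le.2 ha1)

/-! ### The lower bound by the competitor `log |z₁ z₂|` -/

theorem circleIntegrable_log_norm_affine (a b : ℂ) :
    CircleIntegrable (fun ζ => Real.log ‖a + ζ * b‖) 0 1 :=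
  MeromorphicOn.circleIntegrable_log_norm (f := fun ζ => a + ζ * b) fun z _ => by fun_prop

theorem ae_circleMap_ne (w : ℂ) : ∀ᵐ θ : ℝ, circleMap 0 1 θ ≠ w :=
  ((Set.countable_singleton w).preimage_circleMap 0 (one_ne_zero (α := ℝ))).ae_notMem volume

theorem ae_add_circleMap_mul_ne_zero {a : ℂ} (ha : a ≠ 0) (b : ℂ) :
    ∀ᵐ θ : ℝ, a + circleMap 0 1 θ * b ≠ 0 := by
  rcases eq_or_ne b 0 with rfl | hb
  · simp [ha]
  filter_upwards [ae_circleMap_ne (-a / b)] with θ hθ h0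
  exact hθ (by rw [eq_div_iff hb]; linear_combination h0)

/-- Jensen's formula: the mean of `log |ζ + a / b|` is `log⁺ |a / b| ≥ log |a / b|`. -/
theorem log_norm_le_circleAverage_affine {a : ℂ} (ha : a ≠ 0) (b : ℂ) :
    Real.log ‖a‖ ≤ Real.circleAverage (fun ζ => Real.log ‖a + ζ * b‖) 0 1 := by
  rcases eq_or_ne b 0 with rfl | hb
  · simp [Real.circleAverage_const]
  have hi : CircleIntegrable (fun ζ : ℂ => Real.log ‖ζ + a / b‖) 0 1 := by
    simpa [add_comm] using circleIntegrable_log_norm_affine (a / b) 1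
  have h1 : Real.circleAverage (fun ζ => Real.log ‖a + ζ * b‖) 0 1
      = Real.circleAverage (fun ζ => Real.log ‖b‖ + Real.log ‖ζ + a / b‖) 0 1 := by
    rw [Real.circleAverage_def, Real.circleAverage_def]
    congr 1
    apply intervalIntegral.integral_congr_ae
    filter_upwards [ae_add_circleMap_mul_ne_zero ha b] with θ hθ _
    have : a + circleMap 0 1 θ * b = b * (circleMap 0 1 θ + a / b) := by field_simp; ring
    rw [this] at hθ
    rw [this, norm_mul, Real.log_mul (norm_ne_zero_iff.2 hb)
      (norm_ne_zero_iff.2 (right_ne_zero_of_mul hθ))]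
  rw [h1, Real.circleAverage_fun_add (circleIntegrable_const _ _ _) hi, Real.circleAverage_const,
    circleAverage_log_norm_add_const_eq_posLog, norm_div]
  have h2 := Real.log_div (norm_ne_zero_iff.2 ha) (norm_ne_zero_iff.2 hb)
  have h3 : Real.log (‖a‖ / ‖b‖) ≤ Real.posLog (‖a‖ / ‖b‖) := le_max_right _ _
  linarith

/-- `log |z₁ z₂|` is plurisubharmonic. -/
theorem isPlurisubharmonicOn_log_mul (Ω : Set (ℂ × ℂ)) :
    IsPlurisubharmonicOn (fun z : ℂ × ℂ => ENNReal.log ‖z.1 * z.2‖ₑ) Ω where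
  lt_top z _ := ENNReal.log_lt_top_iff.2 enorm_lt_top
  upperSemicontinuousOn := by
    have : Continuous fun z : ℂ × ℂ => ENNReal.log ‖z.1 * z.2‖ₑ :=
      ENNReal.continuous_log.comp (by fun_prop)
    exact this.continuousOn.upperSemicontinuousOn
  submean := by
    rintro ⟨a₁, a₂⟩ ⟨b₁, b₂⟩ -
    simp only [Prod.smul_mk, Prod.mk_add_mk, smul_eq_mul]
    rcases eq_or_ne (a₁ * a₂) 0 with h0 | h0
    · simp [h0]
    have ha₁ := left_ne_zero_of_mul h0
    have ha₂ := right_ne_zero_of_mul h0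
    rw [unitCircleMean_eq_circleAverage
      (q := fun ζ => Real.log ‖a₁ + ζ * b₁‖ + Real.log ‖a₂ + ζ * b₂‖)
      ((circleIntegrable_log_norm_affine _ _).add (circleIntegrable_log_norm_affine _ _)),
      Real.circleAverage_fun_add (circleIntegrable_log_norm_affine _ _)
        (circleIntegrable_log_norm_affine _ _), ENNReal_log_enorm h0, EReal.coe_le_coe_iff,
      norm_mul, Real.log_mul (norm_ne_zero_iff.2 ha₁) (norm_ne_zero_iff.2 ha₂)]
    · exact add_le_add (log_norm_le_circleAverage_affine ha₁ b₁)
        (log_norm_le_circleAverage_affine ha₂ b₂)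
    · filter_upwards [ae_restrict_of_ae (ae_add_circleMap_mul_ne_zero ha₁ b₁),
        ae_restrict_of_ae (ae_add_circleMap_mul_ne_zero ha₂ b₂)] with θ h1 h2
      rw [ENNReal_log_enorm (mul_ne_zero h1 h2), norm_mul,
        Real.log_mul (norm_ne_zero_iff.2 h1) (norm_ne_zero_iff.2 h2)]

/-- Every pole lies on a coordinate axis, so `|z₁ z₂|` is at most the modulus of one coordinate of
`z - a`; the constants can all be `0`. -/
theorem log_mul_mem_greenCompetitors (ε₁ ε₂ : ℂ) :
    (fun z : ℂ × ℂ => ENNReal.log ‖z.1 * z.2‖ₑ) ∈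
      greenCompetitors bidisk {((0 : ℂ), (0 : ℂ)), (ε₁, 0), (0, ε₂)} := by
  have hle : ∀ z ∈ bidisk, ‖z.1 * z.2‖ ≤ ‖z.1‖ ∧ ‖z.1 * z.2‖ ≤ ‖z.2‖ ∧ ‖z.1 * z.2‖ ≤ 1 := by
    rintro z ⟨h1, h2⟩
    rw [mem_ball_zero_iff] at h1 h2
    rw [norm_mul]
    exact ⟨mul_le_of_le_one_right (norm_nonneg _) h2.le,
      mul_le_of_le_one_left (norm_nonneg _) h1.le, mul_le_one₀ h1.le (norm_nonneg _) h2.le⟩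
  refine ⟨isPlurisubharmonicOn_log_mul _, fun z hz => ?_, fun a ha => ⟨0, fun z hz => ?_⟩⟩
  · simpa using ENNReal_log_enorm_le one_pos (hle z hz).2.2
  · rw [EReal.coe_zero, add_zero]
    apply ENNReal.log_monotone
    rw [enorm_le_iff_norm_le]
    obtain ⟨h1, h2, -⟩ := hle z hz
    have h3 := norm_fst_le (z - a)
    have h4 := norm_snd_le (z - a)
    rcases ha with rfl | rfl | rfl
    · exact h1.trans (by simpa using h3)
    · exact h2.trans (by simpa using h4)
    · exact h1.trans (by simpa using h3)

theorem log_mul_le_threePoleGreen (ε₁ ε₂ : ℂ) (z : bidisk) :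
    ENNReal.log ‖(z : ℂ × ℂ).1 * (z : ℂ × ℂ).2‖ₑ ≤ threePoleGreen ε₁ ε₂ z :=
  le_iSup₂_of_le (f := fun (u : ℂ × ℂ → EReal) (_ : u ∈ greenCompetitors bidisk
    {((0 : ℂ), (0 : ℂ)), (ε₁, 0), (0, ε₂)}) => u (z : ℂ × ℂ)) _
    (log_mul_mem_greenCompetitors ε₁ ε₂) le_rfl

theorem threePoleGreen_zero (ε₁ ε₂ : ℂ) {z : bidisk} (hz : (z : ℂ × ℂ) = 0) :
    threePoleGreen ε₁ ε₂ z = ⊥ := by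
  rw [eq_bot_iff]
  refine iSup₂_le fun u hu => ?_
  obtain ⟨C, hC⟩ := hu.2.2 ((0 : ℂ), (0 : ℂ)) (by simp)
  refine (hC z z.2).trans ?_
  rw [hz]
  simp

/-! ### Disks through two poles, for the antidiagonal -/

theorem mem_bidisk_of_norm_lt {z : ℂ × ℂ} (h1 : ‖z.1‖ < 1) (h2 : ‖z.2‖ < 1) : z ∈ bidisk :=
  ⟨mem_ball_zero_iff.2 h1, mem_ball_zero_iff.2 h2⟩

theorem tendsto_log_sub_log {α : Type*} {l : Filter α} {τ : α → ℂ} (hτ : Tendsto τ l (𝓝 0)) {ζ : ℂ}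
    (hζ : ζ ≠ 0) {r : ℝ} (hr : 0 < r) :
    Tendsto (fun a => Real.log ‖ζ - τ a‖ - Real.log (r - ‖τ a‖)) l
      (𝓝 (Real.log ‖ζ‖ - Real.log r)) := by
  have h1 : Tendsto (fun a => ‖ζ - τ a‖) l (𝓝 ‖ζ‖) := by
    simpa using (tendsto_const_nhds.sub hτ).norm
  have h2 : Tendsto (fun a => r - ‖τ a‖) l (𝓝 r) := by
    simpa using tendsto_const_nhds.sub hτ.norm
  exact (h1.log (norm_ne_zero_iff.2 hζ)).sub (h2.log hr.ne')

/-- Shrinking the disk slightly costs little. -/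
theorem exists_radius {t : ℝ} (ht1 : t < 1) {N B : ℝ} (hB : N * Real.log t < B) :
    ∃ r, t < r ∧ r < 1 ∧ N * (Real.log t - Real.log r) < B := by
  have h1 : ContinuousAt (fun r => N * (Real.log t - Real.log r)) 1 := by
    have := Real.continuousAt_log (one_ne_zero)
    fun_prop
  have h2 : ∀ᶠ r in 𝓝 (1 : ℝ), N * (Real.log t - Real.log r) < B :=
    h1.eventually (gt_mem_nhds (by simpa using hB))
  have h3 : ∀ᶠ r in 𝓝[<] (1 : ℝ), t < r ∧ r < 1 := Ioo_mem_nhdsLT ht1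
  obtain ⟨r, ⟨hr1, hr2⟩, hr3⟩ := (h3.and (h2.filter_mono nhdsWithin_le_nhds)).exists
  exact ⟨r, hr1, hr2, hr3⟩

/-- The disk is `t ↦ (t, ε - t + c t (t - ε))`, which meets `(0, ε)` at `0` and `(ε, 0)` at `ε`; the
pole at the origin is not used. -/
theorem eventually_threePoleGreen_antidiagonal_lt {z₁ : ℂ} (hz : (z₁, -z₁) ∈ bidisk) (hz0 : z₁ ≠ 0)
    {B : ℝ} (hB : 2 * Real.log ‖z₁‖ < B) :
    ∀ᶠ ε in 𝓝[≠] (0 : ℂ), threePoleGreen ε ε ⟨(z₁, -z₁), hz⟩ ≤ (B : EReal) := by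
  have hz1 : ‖z₁‖ < 1 := mem_ball_zero_iff.1 hz.1
  obtain ⟨r, hzr, hr1, hrB⟩ := exists_radius hz1 hB
  have hr0 : 0 < r := (norm_nonneg _).trans_lt hzr
  -- Solves `ε - z₁ + c z₁ (z₁ - ε) = -z₁`, so that the disk ends at `(z₁, -z₁)`; it tends to `0`
  -- with `ε`.
  set c : ℂ → ℂ := fun ε => -ε / (z₁ * (z₁ - ε)) with hc
  have ev1 : ∀ᶠ ε in 𝓝 (0 : ℂ), ‖ε‖ + r + ‖c ε‖ * r * (r + ‖ε‖) < 1 := by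
    have : ContinuousAt (fun ε => ‖ε‖ + r + ‖c ε‖ * r * (r + ‖ε‖)) 0 := by
      have : ContinuousAt c 0 := by
        refine ContinuousAt.div (by fun_prop) (by fun_prop) (by simp [hz0])
      fun_prop
    exact this.eventually (gt_mem_nhds (by simpa [hc] using hr1))
  have ev2 : ∀ᶠ ε in 𝓝 (0 : ℂ), (Real.log ‖z₁ - ε‖ - Real.log (r - ‖ε‖)) +
      (Real.log ‖z₁‖ - Real.log r) < B :=
    ((tendsto_log_sub_log tendsto_id hz0 hr0).add_const _).eventually
      (gt_mem_nhds (by linarith))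
  have ev3 : ∀ᶠ ε in 𝓝 (0 : ℂ), ‖ε‖ < ‖z₁‖ :=
    continuous_norm.continuousAt.eventually (gt_mem_nhds (by simpa using hz0))
  filter_upwards [ev1.filter_mono nhdsWithin_le_nhds, ev2.filter_mono nhdsWithin_le_nhds,
    ev3.filter_mono nhdsWithin_le_nhds, self_mem_nhdsWithin] with ε h1 h2 h3 hε
  have hε0 : ε ≠ 0 := hε
  have hzε : z₁ - ε ≠ 0 := by
    rw [sub_ne_zero]; rintro rfl; exact lt_irrefl _ h3
  have key := pluricomplexGreen_comp_le (P := {((0 : ℂ), (0 : ℂ)), (ε, 0), (0, ε)})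
    (f₁ := fun t => t) (f₂ := fun t => ε - t + c ε * t * (t - ε)) (by fun_prop) (by fun_prop)
    (r := r) (ζ := z₁) (by
      intro t ht
      refine mem_bidisk_of_norm_lt (ht.trans_lt hr1) (lt_of_le_of_lt ?_ h1)
      show ‖ε - t + c ε * t * (t - ε)‖ ≤ _
      calc ‖ε - t + c ε * t * (t - ε)‖ ≤ ‖ε‖ + ‖t‖ + ‖c ε‖ * ‖t‖ * (‖t‖ + ‖ε‖) := by
            refine (norm_add_le _ _).trans ?_
            rw [norm_mul, norm_mul]
            gcongr <;> exact norm_sub_le _ _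
        _ ≤ _ := by gcongr)
    {ε, 0} (by
      intro τ hτ
      rw [Finset.mem_insert, Finset.mem_singleton] at hτ
      rcases hτ with rfl | rfl
      · exact ⟨h3.trans hzr, by simp⟩
      · exact ⟨by simpa using hr0, by simp⟩) hzr.le (by
      rw [Finset.mem_insert, Finset.mem_singleton, not_or]
      exact ⟨sub_ne_zero.1 hzε, hz0⟩)
  have hv : ε - z₁ + c ε * z₁ * (z₁ - ε) = -z₁ := by
    simp only [hc]; field_simp; ring
  simp only [hv] at key
  refine key.trans ?_
  rw [EReal.coe_le_coe_iff, Finset.sum_pair hε0]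
  simpa using h2.le

/-! ### Perturbed conics through three poles -/

theorem exists_mem_nhds_ne {p : ℂ → Prop} {v : ℂ} (hp : ∀ᶠ a in 𝓝 v, p a) (w₁ w₂ : ℂ) :
    ∃ a, p a ∧ a ≠ w₁ ∧ a ≠ w₂ := by
  have h1 : ∀ w, ∀ᶠ a in 𝓝[≠] v, a ≠ w := fun w =>
    nhdsNE_le_cofinite v (Set.finite_singleton w).compl_mem_cofinite
  obtain ⟨a, ha1, ha2, ha3⟩ :=
    ((hp.filter_mono nhdsWithin_le_nhds).and ((h1 w₁).and (h1 w₂))).exists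
  exact ⟨a, ha1, ha2, ha3⟩

/-- Square roots of `ε D`, tending to `0` with `ε`. -/
theorem exists_sqrt_tendsto {D : ℂ} (hD : D ≠ 0) :
    ∃ w : ℂ → ℂ, (∀ ε, w ε ^ 2 = ε * D) ∧ Tendsto w (𝓝[≠] 0) (𝓝[≠] 0) := by
  choose w hw using fun ε : ℂ => IsAlgClosed.exists_pow_nat_eq (ε * D) two_pos
  refine ⟨w, hw, tendsto_nhdsWithin_iff.2 ⟨?_, ?_⟩⟩
  · have h1 : ∀ ε, ‖w ε‖ = √(‖ε * D‖) := fun ε => by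
      rw [← hw, norm_pow, Real.sqrt_sq (norm_nonneg _)]
    rw [tendsto_zero_iff_norm_tendsto_zero]
    simp only [h1]
    have : Continuous fun ε : ℂ => √(‖ε * D‖) := by fun_prop
    exact (this.tendsto' 0 0 (by simp)).mono_left nhdsWithin_le_nhds
  · filter_upwards [self_mem_nhdsWithin] with ε hε h0
    have := hw ε
    rw [h0] at this
    simp [hD] at this
    exact hε this

/-- At `a = v / ζ²` the cubic correction vanishes and `|a| ≤ 1`, so the left side is at most `r² <
1`. Openness leaves room to move `a` off finitely many values, as is needed when `v = 0`. -/
theorem eventually_norm_lt_of_scale {v ζ : ℂ} (hv : ‖v‖ ≤ ‖ζ‖ ^ 2) (hζ : ζ ≠ 0) {r : ℝ}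
    (hr0 : 0 < r) (hr1 : r < 1) :
    ∀ᶠ a in 𝓝 (v / ζ ^ 2), ‖a‖ * r * r + ‖(v - a * ζ * ζ) / (ζ * ζ * ζ)‖ * r * r * r < 1 := by
  have h1 : ContinuousAt (fun a : ℂ => ‖a‖ * r * r + ‖(v - a * ζ * ζ) / (ζ * ζ * ζ)‖ * r * r * r)
      (v / ζ ^ 2) := by fun_prop
  refine h1.eventually (gt_mem_nhds ?_)
  have h2 : v - v / ζ ^ 2 * ζ * ζ = 0 := by field_simp; ring
  have h3 : ‖v / ζ ^ 2‖ ≤ 1 := by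
    rw [norm_div, norm_pow]
    exact div_le_one_of_le₀ hv (by positivity)
  simp only [h2, zero_div, norm_zero, zero_mul, add_zero]
  nlinarith [mul_le_mul_of_nonneg_right h3 (mul_nonneg hr0.le hr0.le)]

/-- One coordinate of the perturbed conic: a cubic polynomial vanishing at `0` and `p`, with
leading behaviour `a t²`, taking the value `v` at `ζ`. -/
noncomputable def conicCoord (a v ζ p q : ℂ) (t : ℂ) : ℂ :=
  a * t * (t - p) + (v - a * ζ * (ζ - p)) / (ζ * (ζ - p) * (ζ - q)) * t * (t - p) * (t - q)

theorem differentiable_conicCoord (a v ζ p q : ℂ) : Differentiable ℂ (conicCoord a v ζ p q) := by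
  unfold conicCoord; fun_prop

theorem conicCoord_zero (a v ζ p q : ℂ) : conicCoord a v ζ p q 0 = 0 := by simp [conicCoord]

theorem conicCoord_left (a v ζ p q : ℂ) : conicCoord a v ζ p q p = 0 := by simp [conicCoord]

theorem conicCoord_right (a v ζ p q : ℂ) : conicCoord a v ζ p q q = a * q * (q - p) := by
  simp [conicCoord]

theorem conicCoord_end (a v : ℂ) {ζ p q : ℂ} (hζ : ζ ≠ 0) (hp : ζ ≠ p) (hq : ζ ≠ q) :
    conicCoord a v ζ p q ζ = v := by
  have := sub_ne_zero.2 hp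
  have := sub_ne_zero.2 hq
  unfold conicCoord
  field_simp
  ring

/-- The triangle inequality gives a bound uniform in `|t| ≤ r` and continuous in `(p, q)`, whose
value at `(0, 0)` is the left side of `h`. -/
theorem eventually_norm_conicCoord_lt {α : Type*} {l : Filter α} {p q : α → ℂ}
    (hp : Tendsto p l (𝓝 0)) (hq : Tendsto q l (𝓝 0)) {a v ζ : ℂ} (hζ : ζ ≠ 0) {r : ℝ}
    (h : ‖a‖ * r * r + ‖(v - a * ζ * ζ) / (ζ * ζ * ζ)‖ * r * r * r < 1) :
    ∀ᶠ x in l, ∀ t : ℂ, ‖t‖ ≤ r → ‖conicCoord a v ζ (p x) (q x) t‖ < 1 := by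
  have h1 : ContinuousAt (fun y : ℂ × ℂ => ‖a‖ * r * (r + ‖y.1‖) +
      ‖(v - a * ζ * (ζ - y.1)) / (ζ * (ζ - y.1) * (ζ - y.2))‖ * r * (r + ‖y.1‖) * (r + ‖y.2‖))
      (0, 0) := by
    have : ContinuousAt (fun y : ℂ × ℂ =>
        (v - a * ζ * (ζ - y.1)) / (ζ * (ζ - y.1) * (ζ - y.2))) (0, 0) :=
      ContinuousAt.div (by fun_prop) (by fun_prop) (by simp [hζ])
    fun_prop
  have h2 := (hp.prodMk_nhds hq).eventually (h1.eventually (gt_mem_nhds (by simpa using h)))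
  filter_upwards [h2] with x hx t ht
  refine lt_of_le_of_lt ?_ hx
  have hr : 0 ≤ r := (norm_nonneg t).trans ht
  have e1 : ∀ y : ℂ, ‖t - y‖ ≤ r + ‖y‖ := fun y => (norm_sub_le t y).trans (by gcongr)
  unfold conicCoord
  refine (norm_add_le _ _).trans ?_
  simp only [norm_mul _ (t - _), norm_mul _ t]
  gcongr <;> exact e1 _

theorem eventually_threePoleGreen_lt (z : bidisk) (hz0 : (z : ℂ × ℂ) ≠ 0)
    {B : ℝ} (hB : 3 / 2 * Real.log ‖(z : ℂ × ℂ)‖ < B) :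
    ∀ᶠ ε in 𝓝[≠] (0 : ℂ), threePoleGreen ε ε z ≤ (B : EReal) := by
  obtain ⟨⟨z₁, z₂⟩, hz⟩ := z
  simp only at hz0 hB ⊢
  set M := ‖(z₁, z₂)‖ with hM
  have hM0 : 0 < M := norm_pos_iff.2 hz0
  have hM1 : M < 1 := mem_ball_zero_iff.1 (bidisk_eq_ball ▸ hz)
  set ζ : ℂ := ((√M : ℝ) : ℂ) with hζdef
  have hζn : ‖ζ‖ = √M := by rw [hζdef, Complex.norm_real, Real.norm_of_nonneg (Real.sqrt_nonneg _)]
  have hζ0 : ζ ≠ 0 := by rw [← norm_pos_iff, hζn]; exact Real.sqrt_pos.2 hM0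
  have hζ2 : ‖ζ‖ ^ 2 = M := by rw [hζn, Real.sq_sqrt hM0.le]
  have hζ1 : ‖ζ‖ < 1 := by rw [hζn, Real.sqrt_lt' one_pos]; simpa using hM1
  have hlog : 3 * Real.log ‖ζ‖ < B := by
    rw [hζn, Real.log_sqrt hM0.le]; linarith
  obtain ⟨r, hζr, hr1, hrB⟩ := exists_radius hζ1 hlog
  have hr0 : 0 < r := (norm_nonneg _).trans_lt hζr
  obtain ⟨a, ha, ha0, -⟩ := exists_mem_nhds_ne (eventually_norm_lt_of_scale (v := z₁)
    (by rw [hζ2]; exact norm_fst_le (z₁, z₂)) hζ0 hr0 hr1) 0 0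
  -- Avoiding `-a` keeps `a + b ≠ 0`, which makes the parameters `s` and `w` below distinct.
  obtain ⟨b, hb, hb0, hab⟩ := exists_mem_nhds_ne (eventually_norm_lt_of_scale (v := z₂)
    (by rw [hζ2]; exact norm_snd_le (z₁, z₂)) hζ0 hr0 hr1) 0 (-a)
  have hab' : a + b ≠ 0 := fun h => hab (eq_neg_of_add_eq_zero_right h)
  -- The conic meets `(ε, 0)` at `s` and `(0, ε)` at `w` if `a s (s - w) = ε = b w (w - s)`. This
  -- forces `s = -(b / a) w` and then `w² = ε a / (b (a + b))`.
  obtain ⟨w, hw, hwt⟩ := exists_sqrt_tendsto (D := a / (b * (a + b)))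
    (div_ne_zero ha0 (mul_ne_zero hb0 hab'))
  have hwt0 : Tendsto w (𝓝[≠] 0) (𝓝 0) := hwt.mono_right nhdsWithin_le_nhds
  set s : ℂ → ℂ := fun ε => -b / a * w ε with hs
  have hst0 : Tendsto s (𝓝[≠] 0) (𝓝 0) := by simpa using hwt0.const_mul (-b / a)
  have hsum : Tendsto (fun ε => (Real.log ‖ζ‖ - Real.log r) +
      ((Real.log ‖ζ - s ε‖ - Real.log (r - ‖s ε‖)) + (Real.log ‖ζ - w ε‖ - Real.log (r - ‖w ε‖))))
      (𝓝[≠] 0) (𝓝 (Real.log ‖ζ‖ - Real.log r + (Real.log ‖ζ‖ - Real.log r +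
        (Real.log ‖ζ‖ - Real.log r)))) :=
    ((tendsto_log_sub_log hst0 hζ0 hr0).add (tendsto_log_sub_log hwt0 hζ0 hr0)).const_add _
  have hnorm : ∀ {p : ℂ → ℂ}, Tendsto p (𝓝[≠] 0) (𝓝 0) → ∀ᶠ ε in 𝓝[≠] (0 : ℂ), ‖p ε‖ < ‖ζ‖ :=
    fun hp => hp.norm.eventually (gt_mem_nhds (by simpa using hζ0))
  have hsumlt := hsum.eventually
    (gt_mem_nhds (show _ + (_ + _) < B by linarith))
  filter_upwards [hsumlt, hnorm hst0, hnorm hwt0,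
    eventually_norm_conicCoord_lt hwt0 hst0 hζ0 ha, eventually_norm_conicCoord_lt hst0 hwt0 hζ0 hb,
    hwt.eventually self_mem_nhdsWithin] with ε hlt hsζ hwζ hf₁ hf₂ hw0
  have hw0' : w ε ≠ 0 := hw0
  have hs0 : s ε ≠ 0 := mul_ne_zero (div_ne_zero (neg_ne_zero.2 hb0) ha0) hw0'
  have hsw : s ε ≠ w ε := by
    intro h
    have h1 : -b / a * w ε = 1 * w ε := by rw [one_mul]; exact h
    have h2 := mul_right_cancel₀ hw0' h1
    rw [div_eq_iff ha0] at h2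
    exact hab' (by linear_combination -h2)
  have hζs : ζ ≠ s ε := by rintro h; rw [← h] at hsζ; exact lt_irrefl _ hsζ
  have hζw : ζ ≠ w ε := by rintro h; rw [← h] at hwζ; exact lt_irrefl _ hwζ
  have hε : w ε ^ 2 * (b * (a + b)) = ε * a := by
    rw [hw, mul_assoc, div_mul_cancel₀ _ (mul_ne_zero hb0 hab')]
  have e1 : a * s ε * (s ε - w ε) = ε := by
    simp only [hs]; field_simp; linear_combination hε
  have e2 : b * w ε * (w ε - s ε) = ε := by
    simp only [hs]; field_simp; linear_combination hε
  have key := pluricomplexGreen_comp_le (P := {((0 : ℂ), (0 : ℂ)), (ε, 0), (0, ε)})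
    (differentiable_conicCoord a z₁ ζ (w ε) (s ε)) (differentiable_conicCoord b z₂ ζ (s ε) (w ε))
    (r := r) (ζ := ζ) (fun t ht => mem_bidisk_of_norm_lt (hf₁ t ht) (hf₂ t ht))
    {0, s ε, w ε} (by
      intro τ hτ
      simp only [Finset.mem_insert, Finset.mem_singleton] at hτ
      rcases hτ with rfl | rfl | rfl
      · exact ⟨by simpa using hr0, by simp [conicCoord_zero]⟩
      · exact ⟨hsζ.trans hζr, by simp [conicCoord_left, conicCoord_right, e1]⟩
      · exact ⟨hwζ.trans hζr, by simp [conicCoord_left, conicCoord_right, e2]⟩) hζr.le (by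
      simp only [Finset.mem_insert, Finset.mem_singleton, not_or]
      exact ⟨hζ0, hζs, hζw⟩)
  rw [conicCoord_end _ _ hζ0 hζw hζs, conicCoord_end _ _ hζ0 hζs hζw] at key
  refine key.trans ?_
  rw [EReal.coe_le_coe_iff, Finset.sum_insert (by simp [hs0.symm, hw0'.symm]),
    Finset.sum_pair hsw]
  simpa using hlt.le

theorem mainTheorem3 (g : bidisk → EReal)
    (hg : MapClusterPt g (𝓝[≠] (0 : ℂ)) (fun ε : ℂ => threePoleGreen ε ε)) :
    (∀ z : bidisk, g z ≤ ((3 / 2 : ℝ) : EReal) * ENNReal.log ‖(z : ℂ × ℂ)‖ₑ) ∧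
    (∀ (z₁ : ℂ) (hz : (z₁, -z₁) ∈ bidisk),
      g ⟨(z₁, -z₁), hz⟩ = 2 * ENNReal.log ‖z₁‖ₑ) := by
  have hzero : ∀ z : bidisk, (z : ℂ × ℂ) = 0 → g z = ⊥ := fun z hz =>
    le_bot_iff.1 (hg.apply_le_of_eventually_le fun B _ =>
      Eventually.of_forall fun ε => by rw [threePoleGreen_zero ε ε hz]; exact bot_le)
  refine ⟨fun z => ?_, fun z₁ hz => ?_⟩
  · rcases eq_or_ne (z : ℂ × ℂ) 0 with hz | hz
    · rw [hzero z hz]; exact bot_le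
    rw [ENNReal_log_enorm hz, ← EReal.coe_mul]
    exact hg.apply_le_of_eventually_le fun B hB =>
      eventually_threePoleGreen_lt z hz (EReal.coe_lt_coe_iff.1 hB)
  · rcases eq_or_ne z₁ 0 with rfl | hz0
    · rw [hzero _ (by simp)]
      simp [EReal.mul_bot_of_pos]
    apply le_antisymm
    · rw [ENNReal_log_enorm hz0, show (2 : EReal) = ((2 : ℝ) : EReal) from rfl, ← EReal.coe_mul]
      exact hg.apply_le_of_eventually_le fun B hB =>
        eventually_threePoleGreen_antidiagonal_lt hz hz0 (EReal.coe_lt_coe_iff.1 hB)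
    · refine hg.le_apply_of_eventually_le (Eventually.of_forall fun ε => ?_)
      refine le_trans (le_of_eq ?_) (log_mul_le_threePoleGreen ε ε _)
      rw [ENNReal_log_enorm hz0, ENNReal_log_enorm (mul_ne_zero hz0 (neg_ne_zero.2 hz0)),
        norm_mul, norm_neg, Real.log_mul (norm_ne_zero_iff.2 hz0) (norm_ne_zero_iff.2 hz0),
        ← two_mul, EReal.coe_mul]
      rfl
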